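/- **Theorem.** Let $\psi=\Gamma'/\Gamma$ be the digamma function, $\psi'$ its derivative, $\gamma$ the Euler–Mascheroni constant, and $${}_4F_3\!\left(\begin{matrix}1,1,1,m-c\\2,2,m\end{matrix}\,\middle|\,1\right)=\sum_{k\ge 0}\frac{(1)_k^3\,(m-c)_k}{(2)_k^2\,(m)_k\,k!},\qquad (x)_k=x(x+1)\cdots(x+k-1).$$ Let $c,m\in\mathbb C$ with $\Re(c)>-1$, $c\neq 0$, $\Re(m-c)>0$ and $m\notin\{0,1\}$. Then the series defining this ${}_4F_3$ converges absolutely, and the following hold. (a) If $\Re(m-c)>1$, then, with absolute convergence of the left-hand side, $$\sum_{l=0}^{\infty}\frac{\Gamma(c+l)\,\psi(1+l)^2}{\Gamma(m+l)}=-\frac{\Gamma(c)}{\Gamma(m)}\,{}_4F_3\!\left(\begin{matrix}1,1,1,m-c\\2,2,m\end{matrix}\,\middle|\,1\right)+\frac{\Gamma(c)}{\Gamma(m-1)(m-1-c)}\Big[\frac{\pi^2}{6}+\gamma^2+\psi(m-1-c)\big(2\gamma-\psi(m-1)-\psi(c)\big)+\psi'(m-1-c)+\psi(m-1-c)^2-\psi(m-1)\big(2\gamma-\psi(c)\big)\Big].$$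 (b) If $m\neq c+1$, then, with absolute convergence of the left-hand side, $$\sum_{l=0}^{\infty}\frac{\Gamma(c+l)\,\psi'(1+l)}{\Gamma(m+l)}=\frac{\Gamma(c)}{\Gamma(m)}\,{}_4F_3\!\left(\begin{matrix}1,1,1,m-c\\2,2,m\end{matrix}\,\middle|\,1\right)-\frac{\Gamma(c)}{\Gamma(m-1)(m-1-c)}\Big(\psi'(m-1)-\big[\psi(m-1)-\psi(m-1-c)\big]\big[\psi(m-1)-\psi(c)\big]\Big).$$ -/

import Mathlib

/-- The `k`-th term
`(a₁)ₖ ⋯ (a_p)ₖ / ((b₁)ₖ ⋯ (b_q)ₖ) * z ^ k / k!`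
of the generalized hypergeometric series `pFq(a₁, …, a_p; b₁, …, b_q; z)`, where `(x)ₖ` is the
rising factorial `x (x + 1) ⋯ (x + k - 1)`. -/
noncomputable def genHypTerm (as bs : List ℂ) (z : ℂ) (k : ℕ) : ℂ :=
  (as.map fun a => (ascPochhammer ℂ k).eval a).prod /
    (bs.map fun b => (ascPochhammer ℂ k).eval b).prod * (z ^ k / (k.factorial : ℂ))

/-- The generalized hypergeometric function `pFq(as; bs; z)`, as the sum of its defining series. -/
noncomputable def genHyp (as bs : List ℂ) (z : ℂ) : ℂ :=
  ∑' k : ℕ, genHypTerm as bs z k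

/-- The trigamma function: the derivative of the digamma function. -/
noncomputable def trigamma : ℂ → ℂ := deriv Complex.digamma

/-! Gauss's evaluation of `₂F₁(a, e; b; 1)`, differentiated in `e`, gives
`∑ₖ (a)ₖ / ((b)ₖ k) = ψ(b) - ψ(b - a)` at `e = 0` and, after a second derivative at `e = 1`, the
series with weight `ψ² + ψ'`. Summation by parts turns the series with weight `ψ'` into a `₄F₃`, so
both parts of the theorem reduce to a reflection formula exchanging `c` and `m - 1 - c` in this
`₄F₃`. The defect of the reflection formula is invariant under integer shifts of the parameters and
tends to `0` when one of them goes to infinity. -/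

open Filter Topology Asymptotics

lemma ne_neg_natCast_of_re_pos {z : ℂ} (hz : 0 < z.re) (k : ℕ) : z ≠ -k := by
  rintro rfl
  simp only [Complex.neg_re, Complex.natCast_re, Left.neg_pos_iff] at hz
  exact hz.not_ge k.cast_nonneg

lemma ne_neg_natCast_of_neg_one_lt_re {z : ℂ} (hz : -1 < z.re) (hz0 : z ≠ 0) (k : ℕ) :
    z ≠ -k := by
  rintro rfl
  simp only [Complex.neg_re, Complex.natCast_re, neg_lt_neg_iff, Nat.cast_lt_one] at hz
  exact hz0 (by simp [hz])

lemma ne_neg_natCast_add {z : ℂ} (hz : ∀ k : ℕ, z ≠ -k) (n k : ℕ) : z + n ≠ -k := fun h =>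
  hz (n + k) (by push_cast; linear_combination h)

lemma ne_neg_natCast_add_one {z : ℂ} (hz : ∀ k : ℕ, z ≠ -k) (k : ℕ) : z + 1 ≠ -k := by
  simpa using ne_neg_natCast_add hz 1 k

lemma ne_neg_natCast_of_add_one {z : ℂ} (hz : ∀ k : ℕ, z + 1 ≠ -k) (hz0 : z ≠ 0) (k : ℕ) :
    z ≠ -k := by
  rintro rfl
  cases k with
  | zero => simp at hz0
  | succ k => exact hz k (by push_cast; ring)

lemma add_natCast_ne_zero {z : ℂ} (hz : ∀ k : ℕ, z ≠ -k) (k : ℕ) : z + k ≠ 0 := fun h =>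
  hz k (eq_neg_of_add_eq_zero_left h)

lemma ne_zero_of_ne_neg_natCast {z : ℂ} (hz : ∀ k : ℕ, z ≠ -k) : z ≠ 0 := by
  simpa using hz 0

lemma isBigO_rpow_mul_rpow {f g : ℕ → ℂ} {r s : ℝ} (hf : f =O[atTop] fun n : ℕ => (n : ℝ) ^ r)
    (hg : g =O[atTop] fun n : ℕ => (n : ℝ) ^ s) :
    (fun n => f n * g n) =O[atTop] fun n : ℕ => (n : ℝ) ^ (r + s) := by
  refine (hf.mul hg).congr' EventuallyEq.rfl ?_
  filter_upwards [eventually_gt_atTop 0] with n hn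
  rw [Real.rpow_add (by exact_mod_cast hn)]

lemma summable_of_isBigO_rpow {f : ℕ → ℂ} {r : ℝ} (hf : f =O[atTop] fun n : ℕ => (n : ℝ) ^ r)
    (hr : r < -1) : Summable f :=
  summable_of_isBigO_nat (Real.summable_nat_rpow.2 hr) hf

lemma tendsto_zero_of_isBigO_rpow {f : ℕ → ℂ} {r : ℝ}
    (hf : f =O[atTop] fun n : ℕ => (n : ℝ) ^ r) (hr : r < 0) : Tendsto f atTop (𝓝 0) := by
  refine hf.trans_tendsto ?_
  simpa only [neg_neg, Function.comp_def] using
    (tendsto_rpow_neg_atTop (neg_pos.2 hr)).comp (tendsto_natCast_atTop_atTop (R := ℝ))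

lemma isBigO_inv_add_natCast (z : ℂ) :
    (fun n : ℕ => (z + n)⁻¹) =O[atTop] fun n : ℕ => (n : ℝ) ^ (-1 : ℝ) := by
  have h := ((tendsto_natCast_div_add_atTop z).isBigO_one ℝ).mul
    (isBigO_refl (fun n : ℕ => ((n : ℂ))⁻¹) atTop).norm_right
  refine h.congr' ?_ (Eventually.of_forall fun n => by simp [Real.rpow_neg_one])
  filter_upwards [eventually_ne_atTop 0] with n hn
  have hn' : (n : ℂ) ≠ 0 := by exact_mod_cast hn
  rw [div_mul_eq_mul_div, mul_inv_cancel₀ hn', one_div, add_comm]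

lemma isBigO_inv_natCast_add_one :
    (fun n : ℕ => ((n : ℂ) + 1)⁻¹) =O[atTop] fun n : ℕ => (n : ℝ) ^ (-1 : ℝ) :=
  (isBigO_inv_add_natCast 1).congr_left fun n => by rw [add_comm]

lemma isBigO_inv_natCast_add_one_sq :
    (fun n : ℕ => (((n : ℂ) + 1) ^ 2)⁻¹) =O[atTop] fun n : ℕ => (n : ℝ) ^ (-2 : ℝ) := by
  have h := isBigO_rpow_mul_rpow isBigO_inv_natCast_add_one isBigO_inv_natCast_add_one
  norm_num only at h
  exact h.congr_left fun n => by rw [sq, mul_inv]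

lemma hasSum_sub_succ {g : ℕ → ℂ} (hs : Summable fun n => g n - g (n + 1))
    (hg : Tendsto g atTop (𝓝 0)) : HasSum (fun n => g n - g (n + 1)) (g 0) := by
  refine hs.hasSum_iff_tendsto_nat.2 ?_
  simpa only [Finset.sum_range_sub', sub_zero] using tendsto_const_nhds.sub hg

/-- The ratio `(a)ₖ / (b)ₖ` of rising factorials. -/
noncomputable def pochRatio (a b : ℂ) (k : ℕ) : ℂ :=
  (ascPochhammer ℂ k).eval a / (ascPochhammer ℂ k).eval b

@[simp] lemma pochRatio_zero (a b : ℂ) : pochRatio a b 0 = 1 := by simp [pochRatio]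

lemma pochRatio_succ (a b : ℂ) (k : ℕ) :
    pochRatio a b (k + 1) = pochRatio a b k * ((a + k) / (b + k)) := by
  simp only [pochRatio, ascPochhammer_succ_eval]
  rw [mul_div_mul_comm]

lemma pochRatio_succ' (a b : ℂ) (k : ℕ) :
    pochRatio a b (k + 1) = a / b * pochRatio (a + 1) (b + 1) k := by
  induction k with
  | zero => simp [pochRatio_succ]
  | succ k ih =>
    rw [pochRatio_succ, ih, pochRatio_succ]
    push_cast
    ring

lemma pochRatio_mul_pochRatio_one_left (a b : ℂ) (k : ℕ) :
    pochRatio a 1 k * pochRatio 1 b k = pochRatio a b k := by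
  have h1 : (ascPochhammer ℂ k).eval 1 ≠ 0 := by
    rw [ascPochhammer_eval_one]
    exact_mod_cast k.factorial_ne_zero
  simp only [pochRatio]
  field_simp

lemma pochRatio_self {a : ℂ} (ha : ∀ k : ℕ, a ≠ -k) (k : ℕ) : pochRatio a a k = 1 := by
  refine div_self fun h => ?_
  obtain ⟨n, -, hn⟩ := (ascPochhammer_eval_eq_zero_iff k a).1 h
  exact ha n (by rw [hn, neg_neg])

lemma pochRatio_one_two (k : ℕ) : pochRatio 1 2 k = ((k : ℂ) + 1)⁻¹ := by
  induction k with
  | zero => simp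
  | succ k ih =>
    have h1 : (k : ℂ) + 1 ≠ 0 := Nat.cast_add_one_ne_zero k
    rw [pochRatio_succ, ih]
    push_cast
    rw [add_comm (1 : ℂ), show (k : ℂ) + 1 + 1 = 2 + k by ring]
    field_simp

lemma pochRatio_add_one_left {a : ℂ} (ha : a ≠ 0) (b : ℂ) (k : ℕ) :
    pochRatio (a + 1) b k = pochRatio a b k * ((a + k) / a) := by
  induction k with
  | zero => simp [ha]
  | succ k ih =>
    rw [pochRatio_succ, ih, pochRatio_succ]
    push_cast
    ring

lemma pochRatio_add_one_right (a : ℂ) {b : ℂ} (hb : ∀ k : ℕ, b ≠ -k) (k : ℕ) :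
    pochRatio a (b + 1) k = pochRatio a b k * (b / (b + k)) := by
  have hb0 := ne_zero_of_ne_neg_natCast hb
  induction k with
  | zero => simp [hb0]
  | succ k ih =>
    have h1 := add_natCast_ne_zero hb k
    have h2 := add_natCast_ne_zero hb (k + 1)
    rw [pochRatio_succ, ih, pochRatio_succ]
    push_cast at h2 ⊢
    rw [add_right_comm b 1, add_assoc b]
    field_simp

lemma pochRatio_sub_succ (a : ℂ) {b : ℂ} (hb : ∀ k : ℕ, b ≠ -k) (k : ℕ) :
    pochRatio a b k - pochRatio a b (k + 1) = (b - a) / b * pochRatio a (b + 1) k := by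
  have hb0 := ne_zero_of_ne_neg_natCast hb
  have h1 := add_natCast_ne_zero hb k
  rw [pochRatio_succ, pochRatio_add_one_right a hb]
  field_simp
  ring

lemma pochRatio_add_one_right_sub (a : ℂ) {b : ℂ} (hb : ∀ k : ℕ, b ≠ -k) (k : ℕ) :
    pochRatio a (b + 1) k - pochRatio a b k = -(k / b) * pochRatio a (b + 1) k := by
  have hb0 := ne_zero_of_ne_neg_natCast hb
  have h1 := add_natCast_ne_zero hb k
  rw [pochRatio_add_one_right a hb]
  field_simp
  ring

lemma pochRatio_add_one_add_one_sub {a b : ℂ} (ha : a ≠ 0) (hb : ∀ k : ℕ, b ≠ -k) (k : ℕ) :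
    pochRatio (a + 1) (b + 1) k - pochRatio a b k
      = (b - a) / (a * b) * k * pochRatio a (b + 1) k := by
  have hb0 := ne_zero_of_ne_neg_natCast hb
  have h1 := add_natCast_ne_zero hb k
  rw [pochRatio_add_one_left ha, pochRatio_add_one_right a hb]
  field_simp
  ring

lemma Gamma_add_natCast_div {a b : ℂ} (ha : ∀ k : ℕ, a ≠ -k) (hb : ∀ k : ℕ, b ≠ -k) (k : ℕ) :
    Complex.Gamma (a + k) / Complex.Gamma (b + k)
      = Complex.Gamma a / Complex.Gamma b * pochRatio a b k := by
  have hΓa := Complex.Gamma_ne_zero ha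
  have hΓb := Complex.Gamma_ne_zero hb
  have hΓbk := Complex.Gamma_ne_zero (ne_neg_natCast_add hb k)
  rw [pochRatio, ← Complex.Gamma_add_nat_div_Gamma_eq a ha,
    ← Complex.Gamma_add_nat_div_Gamma_eq b hb]
  field_simp

lemma GammaSeq_div_GammaSeq (a b : ℂ) {n : ℕ} (hn : n ≠ 0) :
    Complex.GammaSeq b n / Complex.GammaSeq a n = (n : ℂ) ^ (b - a) * pochRatio a b (n + 1) := by
  have hprod (x : ℂ) (n : ℕ) :
      (ascPochhammer ℂ n).eval x = ∏ j ∈ Finset.range n, (x + j) := by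
    induction n with
    | zero => simp
    | succ k ih => rw [ascPochhammer_succ_eval, ih, Finset.prod_range_succ]
  have hn' : (n : ℂ) ≠ 0 := by exact_mod_cast hn
  have hfac : (n.factorial : ℂ) ≠ 0 := by exact_mod_cast n.factorial_ne_zero
  rw [Complex.GammaSeq, Complex.GammaSeq, pochRatio, hprod, hprod, Complex.cpow_sub _ _ hn',
    div_div_div_eq, mul_right_comm, ← mul_assoc, mul_div_mul_right _ _ hfac,
    mul_comm _ ((n : ℂ) ^ a), mul_div_mul_comm]

lemma tendsto_inv_GammaSeq (a : ℂ) :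
    Tendsto (fun n => (Complex.GammaSeq a n)⁻¹) atTop (𝓝 (Complex.Gamma a)⁻¹) := by
  by_cases ha : Complex.Gamma a = 0
  · obtain ⟨k, rfl⟩ := (Complex.Gamma_eq_zero_iff a).1 ha
    refine tendsto_const_nhds.congr' ?_
    filter_upwards [eventually_ge_atTop k] with n hn
    have hprod : ∏ j ∈ Finset.range (n + 1), (-(k : ℂ) + j) = 0 :=
      Finset.prod_eq_zero (Finset.mem_range.2 (Nat.lt_succ_of_le hn)) (neg_add_cancel _)
    rw [ha, Complex.GammaSeq, hprod, div_zero]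
  · exact (Complex.GammaSeq_tendsto_Gamma a).inv₀ ha

lemma tendsto_cpow_mul_pochRatio (a b : ℂ) :
    Tendsto (fun n : ℕ => (n : ℂ) ^ (b - a) * pochRatio a b n) atTop
      (𝓝 (Complex.Gamma b / Complex.Gamma a)) := by
  have hq : Tendsto (fun n : ℕ => (b + n) / (a + n)) atTop (𝓝 1) := by
    simpa using tendsto_add_mul_div_add_mul_atTop_nhds b a 1 one_ne_zero
  have h := ((Complex.GammaSeq_tendsto_Gamma b).mul (tendsto_inv_GammaSeq a)).mul hq
  rw [mul_one] at h
  have hne (z : ℂ) : ∀ᶠ n : ℕ in atTop, z + n ≠ 0 := by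
    filter_upwards [tendsto_natCast_atTop_atTop.eventually_gt_atTop (-z.re)] with n hn h0
    have hre := congrArg Complex.re h0
    rw [Complex.add_re, Complex.natCast_re, Complex.zero_re] at hre
    linarith
  refine h.congr' ?_
  filter_upwards [eventually_ne_atTop 0, hne a, hne b] with n hn han hbn
  rw [← div_eq_mul_inv, GammaSeq_div_GammaSeq a b hn, pochRatio_succ]
  field_simp

lemma isBigO_pochRatio (a b : ℂ) :
    pochRatio a b =O[atTop] fun n : ℕ => (n : ℝ) ^ (a - b).re := by
  have h := ((tendsto_cpow_mul_pochRatio a b).isBigO_one ℝ).norm_left.mul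
    (isBigO_refl (fun n : ℕ => (n : ℝ) ^ (a - b).re) atTop)
  refine IsBigO.of_norm_left (h.congr' ?_ (Eventually.of_forall fun n => one_mul _))
  filter_upwards [eventually_gt_atTop 0] with n hn
  rw [norm_mul, Complex.norm_natCast_cpow_of_pos hn, mul_right_comm,
    ← Real.rpow_add (Nat.cast_pos.2 hn)]
  simp

lemma isBigO_pochRatio_succ (a b : ℂ) :
    (fun n => pochRatio a b (n + 1)) =O[atTop] fun n : ℕ => (n : ℝ) ^ (a - b).re := by
  have h := (isBigO_pochRatio (a + 1) (b + 1)).const_mul_left (a / b)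
  rw [add_sub_add_right_eq_sub] at h
  exact h.congr_left fun n => (pochRatio_succ' a b n).symm

lemma norm_pochRatio_le {a b : ℂ} {r ρ : ℝ} (ha : ‖a‖ ≤ r) (hρ : 0 < ρ) (hb : ρ ≤ b.re) (k : ℕ) :
    ‖pochRatio a b k‖ ≤ ‖pochRatio r ρ k‖ := by
  induction k with
  | zero => simp
  | succ k ih =>
    have hnum : ‖a + k‖ ≤ ‖(r : ℂ) + k‖ := calc
      ‖a + k‖ ≤ r + k := (norm_add_le _ _).trans (by simpa using ha)
      _ = ((r : ℂ) + k).re := by simp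
      _ ≤ ‖(r : ℂ) + k‖ := Complex.re_le_norm _
    have hρk : ‖(ρ : ℂ) + k‖ = ρ + k := by
      rw [← Complex.ofReal_natCast, ← Complex.ofReal_add, Complex.norm_of_nonneg (by positivity)]
    have hden : ‖(ρ : ℂ) + k‖ ≤ ‖b + k‖ := calc
      ‖(ρ : ℂ) + k‖ ≤ (b + k).re := by simpa [hρk] using hb
      _ ≤ ‖b + k‖ := Complex.re_le_norm _
    have hpos : 0 < ‖(ρ : ℂ) + k‖ := by rw [hρk]; positivity
    rw [pochRatio_succ, pochRatio_succ, norm_mul, norm_mul, norm_div, norm_div]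
    gcongr

lemma isBigO_tsum_pochRatio_add_natCast (a b : ℂ) {g : ℕ → ℂ} {s : ℝ}
    (hg : g =O[atTop] fun k : ℕ => (k : ℝ) ^ s) :
    (fun n : ℕ => ∑' k, pochRatio a (b + n) (k + 1) * g k) =O[atTop]
      fun n : ℕ => (n : ℝ) ^ (-1 : ℝ) := by
  set r : ℝ := ‖a + 1‖
  set ρ : ℝ := r + |s| + 2
  have hρ : 0 < ρ := by dsimp only [ρ, r]; positivity
  have hs : Summable fun k => ‖pochRatio r ρ k * g k‖ := by
    refine (summable_of_isBigO_rpow (isBigO_rpow_mul_rpow (isBigO_pochRatio r ρ) hg) ?_).norm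
    simp only [← Complex.ofReal_sub, Complex.ofReal_re]
    linarith [le_abs_self s]
  have hbound : ∀ᶠ n : ℕ in atTop, ‖∑' k, pochRatio a (b + n) (k + 1) * g k‖ ≤
      ‖a * ∑' k, ‖pochRatio r ρ k * g k‖‖ * ‖(b + n)⁻¹‖ := by
    filter_upwards [tendsto_natCast_atTop_atTop.eventually_ge_atTop (ρ - b.re)] with n hn
    have hre : ρ ≤ (b + n + 1).re := by
      simp only [Complex.add_re, Complex.natCast_re, Complex.one_re]
      linarith
    have hterm : ∀ k, ‖pochRatio (a + 1) (b + n + 1) k * g k‖ ≤ ‖pochRatio r ρ k * g k‖ := by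
      intro k
      rw [norm_mul, norm_mul]
      gcongr
      exact norm_pochRatio_le le_rfl hρ hre k
    simp_rw [pochRatio_succ', mul_assoc (a / _), tsum_mul_left]
    rw [norm_mul, norm_div, norm_inv, norm_mul, Complex.norm_of_nonneg (by positivity),
      mul_right_comm, ← div_eq_mul_inv]
    gcongr
    exact tsum_of_norm_bounded hs.hasSum hterm
  exact (IsBigO.of_bound _ hbound).trans (isBigO_inv_add_natCast b)

section Gauss

variable {a b e : ℂ}

lemma summable_pochRatio_mul_pochRatio_one (h : 0 < (b - a - e).re) :
    Summable fun k => pochRatio a b k * pochRatio e 1 k := by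
  refine summable_of_isBigO_rpow
    (isBigO_rpow_mul_rpow (isBigO_pochRatio a b) (isBigO_pochRatio e 1)) ?_
  simp only [Complex.sub_re, Complex.one_re] at h ⊢
  linarith

lemma pochRatio_mul_pochRatio_one_contiguous (a e : ℂ) (hb : ∀ k : ℕ, b ≠ -k) (k : ℕ) :
    b * (b - a - e) * (pochRatio a b k * pochRatio e 1 k)
        - (b - a) * (b - e) * (pochRatio a (b + 1) k * pochRatio e 1 k)
      = b * (k * (pochRatio a b k * pochRatio e 1 k)
        - (k + 1 : ℕ) * (pochRatio a b (k + 1) * pochRatio e 1 (k + 1))) := by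
  have hbk := add_natCast_ne_zero hb k
  have hk : (1 : ℂ) + k ≠ 0 := by rw [add_comm]; exact Nat.cast_add_one_ne_zero k
  rw [pochRatio_succ a b, pochRatio_succ e, pochRatio_add_one_right a hb]
  push_cast
  field_simp
  ring

lemma tendsto_natCast_mul_pochRatio_mul_pochRatio_one (h : 0 < (b - a - e).re) :
    Tendsto (fun k : ℕ => k * (pochRatio a b k * pochRatio e 1 k)) atTop (𝓝 0) := by
  have hk : (fun k : ℕ => (k : ℂ)) =O[atTop] fun k : ℕ => (k : ℝ) ^ (1 : ℝ) :=
    .of_norm_left (by simpa using isBigO_refl _ _)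
  refine tendsto_zero_of_isBigO_rpow (isBigO_rpow_mul_rpow hk
    (isBigO_rpow_mul_rpow (isBigO_pochRatio a b) (isBigO_pochRatio e 1))) ?_
  simp only [Complex.sub_re, Complex.one_re] at h ⊢
  linarith

lemma tsum_pochRatio_mul_pochRatio_one_add_one (hb : ∀ k : ℕ, b ≠ -k)
    (h : 0 < (b - a - e).re) :
    ∑' k, pochRatio a b k * pochRatio e 1 k = (b - a) / b * ((b - e) / (b - a - e)) *
      ∑' k, pochRatio a (b + 1) k * pochRatio e 1 k := by
  have hb0 := ne_zero_of_ne_neg_natCast hb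
  have hbae : b - a - e ≠ 0 := fun h0 => by simp [h0] at h
  have h' : 0 < (b + 1 - a - e).re := by
    rw [add_sub_right_comm, add_sub_right_comm, Complex.add_re, Complex.one_re]
    linarith
  have hdiff := ((summable_pochRatio_mul_pochRatio_one h).hasSum.mul_left
    (b * (b - a - e))).sub ((summable_pochRatio_mul_pochRatio_one h').hasSum.mul_left
    ((b - a) * (b - e)))
  simp_rw [pochRatio_mul_pochRatio_one_contiguous a e hb] at hdiff
  have htel := (hasSum_sub_succ ((summable_mul_left_iff hb0).1 hdiff.summable)
    (tendsto_natCast_mul_pochRatio_mul_pochRatio_one h)).mul_left b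
  have heq := hdiff.unique htel
  simp only [Nat.cast_zero, zero_mul, mul_zero] at heq
  field_simp
  linear_combination heq

lemma tsum_pochRatio_mul_pochRatio_one_add_natCast (hb : ∀ k : ℕ, b ≠ -k)
    (h : 0 < (b - a - e).re) (n : ℕ) :
    ∑' k, pochRatio a b k * pochRatio e 1 k =
      pochRatio (b - a) b n * pochRatio (b - e) (b - a - e) n *
        ∑' k, pochRatio a (b + n) k * pochRatio e 1 k := by
  induction n with
  | zero => simp
  | succ n ih =>
    have hn : 0 < (b + n - a - e).re := by
      rw [add_sub_right_comm, add_sub_right_comm, Complex.add_re, Complex.natCast_re]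
      positivity
    rw [ih, tsum_pochRatio_mul_pochRatio_one_add_one (ne_neg_natCast_add hb n) hn,
      pochRatio_succ, pochRatio_succ]
    push_cast
    rw [← add_assoc]
    ring

lemma tendsto_tsum_pochRatio_mul_pochRatio_one (h : 0 < (b - a - e).re) :
    Tendsto (fun n : ℕ => ∑' k, pochRatio a (b + n) k * pochRatio e 1 k) atTop (𝓝 1) := by
  have htail := tendsto_zero_of_isBigO_rpow
    (isBigO_tsum_pochRatio_add_natCast a b (isBigO_pochRatio_succ e 1)) (by norm_num)
  have := htail.const_add 1
  rw [add_zero] at this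
  refine this.congr fun n => ?_
  have hn : 0 < (b + n - a - e).re := by
    rw [add_sub_right_comm, add_sub_right_comm, Complex.add_re, Complex.natCast_re]
    positivity
  rw [(summable_pochRatio_mul_pochRatio_one hn).tsum_eq_zero_add, pochRatio_zero, pochRatio_zero,
    mul_one]

/-- The value `Γ(b) Γ(b - a - e) / (Γ(b - a) Γ(b - e))` that Gauss's theorem gives to
`₂F₁(a, e; b; 1)`. At a pole of `Γ(b - a)` or `Γ(b - e)` it is correctly `0`, since Mathlib's `Γ`
vanishes there and so does the inverse of `0`. -/
noncomputable def gaussValue (a b e : ℂ) : ℂ :=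
  Complex.Gamma b / Complex.Gamma (b - a) * (Complex.Gamma (b - a - e) / Complex.Gamma (b - e))

theorem hasSum_gaussValue (hb : ∀ k : ℕ, b ≠ -k) (h : 0 < (b - a - e).re) :
    HasSum (fun k => pochRatio a b k * pochRatio e 1 k) (gaussValue a b e) := by
  have hlim := ((tendsto_cpow_mul_pochRatio (b - a) b).mul
    (tendsto_cpow_mul_pochRatio (b - e) (b - a - e))).mul
    (tendsto_tsum_pochRatio_mul_pochRatio_one h)
  rw [mul_one, ← gaussValue] at hlim
  refine (summable_pochRatio_mul_pochRatio_one h).hasSum_iff.2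
    (tendsto_nhds_unique (hlim.congr' ?_) tendsto_const_nhds).symm
  filter_upwards [eventually_ne_atTop 0] with n hn
  have hn' : (n : ℂ) ≠ 0 := by exact_mod_cast hn
  have hcpow : (n : ℂ) ^ (b - (b - a)) * (n : ℂ) ^ (b - a - e - (b - e)) = 1 := by
    rw [← Complex.cpow_add _ _ hn', ← Complex.cpow_zero (n : ℂ)]
    ring_nf
  rw [tsum_pochRatio_mul_pochRatio_one_add_natCast hb h n, mul_mul_mul_comm, hcpow, one_mul]

end Gauss

lemma eventually_ne_neg_natCast {z : ℂ} (hz : ∀ k : ℕ, z ≠ -k) :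
    ∀ᶠ w : ℂ in 𝓝 z, ∀ k : ℕ, w ≠ -k := by
  have hne : (Complex.Gamma z)⁻¹ ≠ 0 := inv_ne_zero (Complex.Gamma_ne_zero hz)
  filter_upwards [Complex.differentiable_one_div_Gamma.continuous.continuousAt.eventually_ne hne]
    with w hw k hwk
  exact hw (by rw [hwk, Complex.Gamma_neg_nat_eq_zero, inv_zero])

lemma analyticAt_Gamma {z : ℂ} (hz : ∀ k : ℕ, z ≠ -k) : AnalyticAt ℂ Complex.Gamma z :=
  Complex.analyticAt_iff_eventually_differentiableAt.2 <|
    (eventually_ne_neg_natCast hz).mono fun _ => Complex.differentiableAt_Gamma _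

lemma hasDerivAt_Gamma {z : ℂ} (hz : ∀ k : ℕ, z ≠ -k) :
    HasDerivAt Complex.Gamma (Complex.Gamma z * Complex.digamma z) z := by
  rw [Complex.digamma_def, logDeriv_apply, mul_div_cancel₀ _ (Complex.Gamma_ne_zero hz)]
  exact (Complex.differentiableAt_Gamma z hz).hasDerivAt

lemma hasDerivAt_digamma {z : ℂ} (hz : ∀ k : ℕ, z ≠ -k) :
    HasDerivAt Complex.digamma (trigamma z) z :=
  ((analyticAt_Gamma hz).deriv.div (analyticAt_Gamma hz)
    (Complex.Gamma_ne_zero hz)).differentiableAt.hasDerivAt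

lemma trigamma_add_one {z : ℂ} (hz : ∀ k : ℕ, z ≠ -k) :
    trigamma (z + 1) = trigamma z - (z ^ 2)⁻¹ := by
  have h1 : HasDerivAt (fun w => Complex.digamma (w + 1)) (trigamma (z + 1)) z :=
    (hasDerivAt_digamma (ne_neg_natCast_add_one hz)).comp_add_const z 1
  have h2 : HasDerivAt (fun w => Complex.digamma w + w⁻¹) (trigamma z + -(z ^ 2)⁻¹) z :=
    (hasDerivAt_digamma hz).add (hasDerivAt_inv (ne_zero_of_ne_neg_natCast hz))
  rw [sub_eq_add_neg]
  refine h1.unique (h2.congr_of_eventuallyEq ?_)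
  filter_upwards [eventually_ne_neg_natCast hz] with w hw using Complex.digamma_apply_add_one w hw

lemma iteratedDeriv_two_of_hasDerivAt_mul {f g : ℂ → ℂ} {g' z : ℂ}
    (hf : ∀ᶠ w in 𝓝 z, HasDerivAt f (f w * g w) w) (hg : HasDerivAt g g' z) :
    iteratedDeriv 2 f z = f z * (g z ^ 2 + g') := by
  have hderiv : deriv f =ᶠ[𝓝 z] fun w => f w * g w := hf.mono fun w hw => hw.deriv
  rw [iteratedDeriv_succ, iteratedDeriv_one, hderiv.deriv_eq, (hf.self_of_nhds.fun_mul hg).deriv]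
  ring

lemma hasSum_iteratedDeriv_of_summable_norm {ι : Type*} {F : ι → ℂ → ℂ} {u : ι → ℝ} {U : Set ℂ}
    {z : ℂ} (hu : Summable u) (hF : ∀ i, DifferentiableOn ℂ (F i) U) (hU : IsOpen U)
    (hle : ∀ i, ∀ w ∈ U, ‖F i w‖ ≤ u i) (hz : z ∈ U) (N : ℕ) :
    HasSum (fun i => iteratedDeriv N (F i) z) (iteratedDeriv N (fun w => ∑' i, F i w) z) := by
  have hsum (s : Finset ι) : DifferentiableOn ℂ (fun w => ∑ i ∈ s, F i w) U :=
    .fun_sum fun i _ => hF i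
  have hlim : TendstoLocallyUniformlyOn
      (fun s : Finset ι => iteratedDeriv N fun w => ∑ i ∈ s, F i w)
      (iteratedDeriv N fun w => ∑' i, F i w) atTop U := by
    induction N with
    | zero =>
      simpa only [iteratedDeriv_zero] using
        (tendstoUniformlyOn_tsum hu hle).tendstoLocallyUniformlyOn
    | succ N ih =>
      simp only [iteratedDeriv_succ]
      refine ih.deriv (.of_forall fun s => ?_) hU
      rw [iteratedDeriv_eq_iterate]
      exact ((hsum s).analyticOnNhd hU).iterated_deriv N |>.differentiableOn
  refine (hlim.tendsto_at hz).congr fun s => ?_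
  exact iteratedDeriv_fun_sum fun i _ => ((hF i).analyticAt (hU.mem_nhds hz)).contDiffAt

lemma differentiable_pochRatio_left (b : ℂ) (k : ℕ) : Differentiable ℂ fun a => pochRatio a b k :=
  (Polynomial.differentiable _).div_const _

lemma hasDerivAt_pochRatio_one {e : ℂ} (he : ∀ k : ℕ, e ≠ -k) (k : ℕ) :
    HasDerivAt (fun x => pochRatio x 1 k)
      (pochRatio e 1 k * (Complex.digamma (e + k) - Complex.digamma e)) e := by
  have hek := ne_neg_natCast_add he k
  have hGamma : (fun x => Complex.Gamma (x + k) / Complex.Gamma x / (ascPochhammer ℂ k).eval 1)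
      =ᶠ[𝓝 e] fun x => pochRatio x 1 k := by
    filter_upwards [eventually_ne_neg_natCast he] with x hx
    rw [Complex.Gamma_add_nat_div_Gamma_eq x hx, pochRatio]
  refine ((((hasDerivAt_Gamma hek).comp_add_const e k).fun_div (hasDerivAt_Gamma he)
    (Complex.Gamma_ne_zero he)).div_const _).congr_of_eventuallyEq hGamma.symm |>.congr_deriv ?_
  have hΓ := Complex.Gamma_ne_zero he
  rw [pochRatio, ← Complex.Gamma_add_nat_div_Gamma_eq e he]
  field_simp

lemma deriv_pochRatio_one_zero (k : ℕ) : deriv (fun e => pochRatio e 1 k) 0 = (k : ℂ)⁻¹ := by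
  cases k with
  | zero => simp
  | succ k =>
    have hfactor : (fun e => pochRatio e 1 (k + 1)) = fun e => e * pochRatio (e + 1) 2 k := by
      funext e
      rw [pochRatio_succ', div_one, one_add_one_eq_two]
    have hder : HasDerivAt (fun e => e * pochRatio (e + 1) 2 k) _ 0 :=
      (hasDerivAt_id' (0 : ℂ)).fun_mul
        ((differentiable_pochRatio_left 2 k (0 + 1)).hasDerivAt.comp_add_const 0 1)
    rw [hfactor, hder.deriv, zero_mul, add_zero, one_mul, zero_add, pochRatio_one_two,
      Nat.cast_succ]

lemma hasDerivAt_gaussValue {a b e : ℂ} (hbae : ∀ k : ℕ, b - a - e ≠ -k)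
    (hbe : ∀ k : ℕ, b - e ≠ -k) :
    HasDerivAt (gaussValue a b)
      (gaussValue a b e * (Complex.digamma (b - e) - Complex.digamma (b - a - e))) e := by
  have hΓ := Complex.Gamma_ne_zero hbe
  refine ((((hasDerivAt_Gamma hbae).comp_const_sub _ e).fun_div
    ((hasDerivAt_Gamma hbe).comp_const_sub _ e) hΓ).const_mul _).congr_deriv ?_
  rw [gaussValue]
  field_simp
  ring
lemma hasSum_mul_iteratedDeriv_pochRatio_one {f : ℕ → ℂ} {s : ℝ}
    (hf : f =O[atTop] fun n : ℕ => (n : ℝ) ^ (-s)) {e : ℂ} (he : ‖e‖ < s) (N : ℕ) :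
    HasSum (fun k => f k * iteratedDeriv N (fun x => pochRatio x 1 k) e)
      (iteratedDeriv N (fun x => ∑' k, f k * pochRatio x 1 k) e) := by
  obtain ⟨r, her, hrs⟩ := exists_between he
  have hu : Summable fun k => ‖f k * pochRatio r 1 k‖ := by
    refine (summable_of_isBigO_rpow (isBigO_rpow_mul_rpow hf (isBigO_pochRatio r 1)) ?_).norm
    rw [Complex.sub_re, Complex.ofReal_re, Complex.one_re]
    linarith
  have hle (k : ℕ) (x : ℂ) (hx : x ∈ Metric.ball 0 r) :
      ‖f k * pochRatio x 1 k‖ ≤ ‖f k * pochRatio r 1 k‖ := by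
    rw [norm_mul, norm_mul]
    gcongr
    exact_mod_cast norm_pochRatio_le (ρ := 1) (mem_ball_zero_iff.1 hx).le one_pos le_rfl k
  have h := hasSum_iteratedDeriv_of_summable_norm hu
    (fun k => ((differentiable_pochRatio_left 1 k).const_mul (f k)).differentiableOn)
    Metric.isOpen_ball hle (mem_ball_zero_iff.2 her) N
  simpa only [iteratedDeriv_const_mul_field] using h

lemma re_sub_pos_of_norm_lt {z e : ℂ} (h : ‖e‖ < z.re) : 0 < (z - e).re := by
  rw [Complex.sub_re]
  linarith [Complex.re_le_norm e]

lemma eventually_norm_lt {e : ℂ} {s : ℝ} (h : ‖e‖ < s) : ∀ᶠ x in 𝓝 e, ‖x‖ < s :=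
  continuous_norm.continuousAt.eventually_lt_const h

lemma hasSum_pochRatio_mul_iteratedDeriv {a b e : ℂ} (hb : ∀ k : ℕ, b ≠ -k)
    (he : ‖e‖ < (b - a).re) (N : ℕ) :
    HasSum (fun k => pochRatio a b k * iteratedDeriv N (fun x => pochRatio x 1 k) e)
      (iteratedDeriv N (gaussValue a b) e) := by
  have hf : pochRatio a b =O[atTop] fun n : ℕ => (n : ℝ) ^ (-(b - a).re) := by
    simpa only [← Complex.neg_re, neg_sub] using isBigO_pochRatio a b
  have hsum : (fun x => ∑' k, pochRatio a b k * pochRatio x 1 k) =ᶠ[𝓝 e] gaussValue a b := by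
    filter_upwards [eventually_norm_lt he] with x hx
    exact (hasSum_gaussValue hb (re_sub_pos_of_norm_lt hx)).tsum_eq
  rw [← hsum.iteratedDeriv_eq]
  exact hasSum_mul_iteratedDeriv_pochRatio_one hf he N

lemma gaussValue_zero {a b : ℂ} (hb : ∀ k : ℕ, b ≠ -k) (hba : ∀ k : ℕ, b - a ≠ -k) :
    gaussValue a b 0 = 1 := by
  have hΓb := Complex.Gamma_ne_zero hb
  have hΓba := Complex.Gamma_ne_zero hba
  rw [gaussValue, sub_zero, sub_zero]
  field_simp

lemma gaussValue_add_one_one {a b : ℂ} (hb : ∀ k : ℕ, b ≠ -k) (hba : ∀ k : ℕ, b - a ≠ -k) :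
    gaussValue a (b + 1) 1 = b / (b - a) := by
  have hΓb := Complex.Gamma_ne_zero hb
  have hΓba := Complex.Gamma_ne_zero hba
  have hba0 := ne_zero_of_ne_neg_natCast hba
  rw [gaussValue, add_sub_cancel_right, add_sub_right_comm, add_sub_cancel_right,
    Complex.Gamma_add_one _ (ne_zero_of_ne_neg_natCast hb), Complex.Gamma_add_one _ hba0]
  field_simp

lemma hasSum_succ {f : ℕ → ℂ} {s : ℂ} (h0 : f 0 = 0) (hf : HasSum f s) :
    HasSum (fun k => f (k + 1)) s := by
  simpa [h0] using (hasSum_nat_add_iff' 1).2 hf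

lemma hasSum_pochRatio_mul_inv_natCast {a b : ℂ} (hb : ∀ k : ℕ, b ≠ -k) (h : 0 < (b - a).re) :
    HasSum (fun k : ℕ => pochRatio a b k * (k : ℂ)⁻¹)
      (Complex.digamma b - Complex.digamma (b - a)) := by
  have hba := ne_neg_natCast_of_re_pos h
  have hsum := hasSum_pochRatio_mul_iteratedDeriv hb (norm_zero.trans_lt h) 1
  have hderiv := (hasDerivAt_gaussValue (a := a) (b := b) (e := 0) (by simpa using hba)
    (by simpa using hb)).deriv
  simpa only [iteratedDeriv_one, deriv_pochRatio_one_zero, hderiv, gaussValue_zero hb hba, one_mul,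
    sub_zero] using hsum

lemma hasSum_pochRatio_mul_inv {a b : ℂ} (hb : ∀ k : ℕ, b ≠ -k) (h : 0 < (b - a).re) :
    HasSum (fun k : ℕ => pochRatio a b (k + 1) * ((k : ℂ) + 1)⁻¹)
      (Complex.digamma b - Complex.digamma (b - a)) := by
  simpa only [Nat.cast_succ] using hasSum_succ (by simp) (hasSum_pochRatio_mul_inv_natCast hb h)

lemma hasSum_trigamma {b : ℂ} (hb : 0 < b.re) :
    HasSum (fun k : ℕ => pochRatio 1 b (k + 1) * (((k : ℂ) + 1) ^ 2)⁻¹) (trigamma b) := by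
  have hb' := ne_neg_natCast_of_re_pos hb
  have hf : (fun k : ℕ => pochRatio 1 b k * (k : ℂ)⁻¹) =O[atTop]
      fun k : ℕ => (k : ℝ) ^ (-b.re) := by
    simpa [sub_add_eq_add_sub] using
      isBigO_rpow_mul_rpow (isBigO_pochRatio 1 b) (isBigO_inv_add_natCast 0)
  have hderiv := hasSum_mul_iteratedDeriv_pochRatio_one hf (norm_zero.trans_lt hb) 1
  have hsum : (fun x => ∑' k : ℕ, pochRatio 1 b k * (k : ℂ)⁻¹ * pochRatio x 1 k) =ᶠ[𝓝 0]
      fun x => Complex.digamma b - Complex.digamma (b - x) := by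
    filter_upwards [eventually_norm_lt (norm_zero.trans_lt hb)] with x hx
    simp_rw [mul_comm _ (pochRatio x 1 _), ← mul_assoc, pochRatio_mul_pochRatio_one_left]
    exact (hasSum_pochRatio_mul_inv_natCast hb' (re_sub_pos_of_norm_lt hx)).tsum_eq
  have hdigamma : HasDerivAt (fun x => Complex.digamma b - Complex.digamma (b - x))
      (trigamma b) 0 := by
    simpa using ((hasDerivAt_digamma (by simpa using hb')).comp_const_sub b 0).const_sub
      (Complex.digamma b)
  rw [iteratedDeriv_one, hsum.deriv_eq, hdigamma.deriv] at hderiv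
  have := hasSum_succ (by simp) hderiv
  simpa only [iteratedDeriv_one, deriv_pochRatio_one_zero, Nat.cast_succ, mul_assoc, ← sq,
    ← inv_pow] using this

lemma hasSum_inv_add_one_sq :
    HasSum (fun k : ℕ => (((k : ℂ) + 1) ^ 2)⁻¹) ((Real.pi : ℂ) ^ 2 / 6) := by
  simpa using hasSum_succ (by simp) (Complex.hasSum_ofReal.2 hasSum_zeta_two)

lemma trigamma_one : trigamma 1 = (Real.pi : ℂ) ^ 2 / 6 := by
  have hone := ne_neg_natCast_of_re_pos (z := 1) one_pos
  refine (hasSum_trigamma one_pos).unique ?_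
  simpa only [pochRatio_self hone, one_mul] using hasSum_inv_add_one_sq

lemma iteratedDeriv_two_gaussValue {a b e : ℂ} (hbae : ∀ k : ℕ, b - a - e ≠ -k)
    (hbe : ∀ k : ℕ, b - e ≠ -k) :
    iteratedDeriv 2 (gaussValue a b) e =
      gaussValue a b e * ((Complex.digamma (b - e) - Complex.digamma (b - a - e)) ^ 2
        + (trigamma (b - a - e) - trigamma (b - e))) := by
  rw [iteratedDeriv_two_of_hasDerivAt_mul (f := gaussValue a b) (g := fun x =>
    Complex.digamma (b - x) - Complex.digamma (b - a - x))
    (g' := trigamma (b - a - e) - trigamma (b - e))]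
  · have hcont (c : ℂ) : Tendsto (fun x => c - x) (𝓝 e) (𝓝 (c - e)) :=
      (continuous_const.sub continuous_id).tendsto e
    filter_upwards [(hcont _).eventually (eventually_ne_neg_natCast hbae),
      (hcont _).eventually (eventually_ne_neg_natCast hbe)] with x hx hx'
    exact hasDerivAt_gaussValue hx hx'
  · exact (((hasDerivAt_digamma hbe).comp_const_sub b e).sub
      ((hasDerivAt_digamma hbae).comp_const_sub (b - a) e)).congr_deriv (by ring)

lemma iteratedDeriv_two_pochRatio_one {e : ℂ} (he : ∀ k : ℕ, e ≠ -k) (k : ℕ) :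
    iteratedDeriv 2 (fun x => pochRatio x 1 k) e =
      pochRatio e 1 k * ((Complex.digamma (e + k) - Complex.digamma e) ^ 2
        + (trigamma (e + k) - trigamma e)) :=
  iteratedDeriv_two_of_hasDerivAt_mul
    (g := fun x => Complex.digamma (x + k) - Complex.digamma x)
    ((eventually_ne_neg_natCast he).mono fun _ hx => hasDerivAt_pochRatio_one hx k)
    (((hasDerivAt_digamma (ne_neg_natCast_add he k)).comp_add_const e k).sub
      (hasDerivAt_digamma he))

theorem hasSum_pochRatio_mul_digamma_sq_add_trigamma {a b : ℂ} (hb : ∀ k : ℕ, b ≠ -k)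
    (h : 0 < (b - a).re) :
    HasSum (fun k : ℕ => pochRatio a (b + 1) k * (Complex.digamma (1 + k) ^ 2 + trigamma (1 + k)))
      (b / (b - a) * ((Complex.digamma b - Complex.digamma (b - a) + Complex.digamma 1) ^ 2
        + trigamma (b - a) - trigamma b + trigamma 1)) := by
  have hone := ne_neg_natCast_of_re_pos (z := 1) one_pos
  have hba := ne_neg_natCast_of_re_pos h
  have he : ‖(1 : ℂ)‖ < (b + 1 - a).re := by simpa [add_sub_right_comm] using h
  have hbe : b + 1 - 1 = b := add_sub_cancel_right b 1
  have hbae : b + 1 - a - 1 = b - a := by ring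
  have hsum := hasSum_pochRatio_mul_iteratedDeriv (ne_neg_natCast_add_one hb) he
  have h0 := hsum 0
  have h1 := hsum 1
  have h2 := hsum 2
  simp only [iteratedDeriv_zero, gaussValue_add_one_one hb hba] at h0
  rw [iteratedDeriv_one, (hasDerivAt_gaussValue (by rwa [hbae]) (by rwa [hbe])).deriv, hbe, hbae,
    gaussValue_add_one_one hb hba] at h1
  rw [iteratedDeriv_two_gaussValue (by rwa [hbae]) (by rwa [hbe]), hbe, hbae,
    gaussValue_add_one_one hb hba] at h2
  simp only [iteratedDeriv_one, (hasDerivAt_pochRatio_one hone _).deriv,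
    iteratedDeriv_two_pochRatio_one hone, pochRatio_self hone, one_mul, mul_one] at h0 h1 h2
  convert (h2.add (h1.mul_left (2 * Complex.digamma 1))).add
    (h0.mul_left (Complex.digamma 1 ^ 2 + trigamma 1)) using 1
  · funext k
    ring
  · ring

lemma isBigO_trigamma_add_natCast (b : ℂ) :
    (fun n : ℕ => trigamma (b + n)) =O[atTop] fun n : ℕ => (n : ℝ) ^ (-1 : ℝ) := by
  refine (isBigO_tsum_pochRatio_add_natCast 1 b isBigO_inv_natCast_add_one_sq).congr' ?_ .rfl
  filter_upwards [tendsto_natCast_atTop_atTop.eventually_gt_atTop (-b.re)] with n hn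
  refine (hasSum_trigamma ?_).tsum_eq
  rw [Complex.add_re, Complex.natCast_re]
  linarith

lemma isBigO_digamma_add_natCast_sub {b : ℂ} (hb : ∀ k : ℕ, b ≠ -k) (a : ℂ) :
    (fun n : ℕ => Complex.digamma (b + n) - Complex.digamma (b - a + n)) =O[atTop]
      fun n : ℕ => (n : ℝ) ^ (-1 : ℝ) := by
  refine (isBigO_tsum_pochRatio_add_natCast a b isBigO_inv_natCast_add_one).congr' ?_ .rfl
  filter_upwards [tendsto_natCast_atTop_atTop.eventually_gt_atTop (-(b - a).re)] with n hn
  have hpos : 0 < (b + n - a).re := by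
    rw [add_sub_right_comm, Complex.add_re, Complex.natCast_re]
    linarith
  rw [(hasSum_pochRatio_mul_inv (ne_neg_natCast_add hb n) hpos).tsum_eq, add_sub_right_comm]

lemma digamma_add_natCast {b : ℂ} (hb : ∀ k : ℕ, b ≠ -k) (n : ℕ) :
    Complex.digamma (b + n) = Complex.digamma b + ∑ j ∈ Finset.range n, (b + j)⁻¹ := by
  induction n with
  | zero => simp
  | succ n ih =>
    rw [Nat.cast_succ, ← add_assoc, Complex.digamma_apply_add_one _ (ne_neg_natCast_add hb n), ih,
      Finset.sum_range_succ, add_assoc]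

lemma isLittleO_digamma_add_natCast_sub_const {b : ℂ} (hb : ∀ k : ℕ, b ≠ -k) (c : ℂ) :
    (fun n : ℕ => Complex.digamma (b + n) - c) =o[atTop] fun n : ℕ => (n : ℝ) := by
  simp_rw [digamma_add_natCast hb, add_sub_right_comm _ _ c]
  refine (isLittleO_const_left.2 (Or.inr ?_)).add (isLittleO_sum_range_of_tendsto_zero
    (tendsto_zero_of_isBigO_rpow (isBigO_inv_add_natCast b) (by norm_num)))
  exact tendsto_norm_atTop_atTop.comp tendsto_natCast_atTop_atTop

/-- The series `∑ₖ (a)ₖ / ((b)ₖ k²)` over `k ≥ 1`. Since `(a)ₖ / (b)ₖ` is the `k`-th moment of the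
beta distribution with parameters `a` and `b - a`, this is the mean of the dilogarithm under it. -/
noncomputable def dilogMean (a b : ℂ) : ℂ :=
  ∑' k : ℕ, pochRatio a b (k + 1) * (((k : ℂ) + 1) ^ 2)⁻¹

section DilogMean

variable {a b : ℂ}

lemma hasSum_dilogMean (hab : -1 < (b - a).re) :
    HasSum (fun k : ℕ => pochRatio a b (k + 1) * (((k : ℂ) + 1) ^ 2)⁻¹) (dilogMean a b) := by
  refine (summable_of_isBigO_rpow (isBigO_rpow_mul_rpow (isBigO_pochRatio_succ a b)
    isBigO_inv_natCast_add_one_sq) ?_).hasSum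
  rw [Complex.sub_re] at hab ⊢
  linarith

lemma dilogMean_add_one_right (hb : ∀ k : ℕ, b ≠ -k) (hab : -1 < (b - a).re) :
    dilogMean a (b + 1) =
      dilogMean a b - b⁻¹ * (Complex.digamma (b + 1) - Complex.digamma (b + 1 - a)) := by
  have hab1 : 0 < (b + 1 - a).re := by
    rw [add_sub_right_comm, Complex.add_re, Complex.one_re]
    linarith
  have h := (hasSum_dilogMean hab).sub
    ((hasSum_pochRatio_mul_inv (ne_neg_natCast_add_one hb) hab1).mul_left b⁻¹)
  rw [← h.tsum_eq, dilogMean]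
  refine tsum_congr fun k => ?_
  have hk : (k : ℂ) + 1 ≠ 0 := Nat.cast_add_one_ne_zero k
  rw [sub_eq_add_neg, ← sub_eq_iff_eq_add', ← sub_mul, pochRatio_add_one_right_sub a hb]
  push_cast
  field_simp

lemma dilogMean_add_one_add_one (ha : a ≠ 0) (hb : ∀ k : ℕ, b ≠ -k) (hab : -1 < (b - a).re) :
    dilogMean (a + 1) (b + 1) = dilogMean a b
      + (b - a) / (a * b) * (Complex.digamma (b + 1) - Complex.digamma (b + 1 - a)) := by
  have hab1 : 0 < (b + 1 - a).re := by
    rw [add_sub_right_comm, Complex.add_re, Complex.one_re]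
    linarith
  have h := (hasSum_dilogMean hab).add
    ((hasSum_pochRatio_mul_inv (ne_neg_natCast_add_one hb) hab1).mul_left ((b - a) / (a * b)))
  rw [← h.tsum_eq, dilogMean]
  refine tsum_congr fun k => ?_
  have hk : (k : ℂ) + 1 ≠ 0 := Nat.cast_add_one_ne_zero k
  rw [← sub_eq_iff_eq_add', ← sub_mul, pochRatio_add_one_add_one_sub ha hb]
  push_cast
  field_simp

theorem hasSum_pochRatio_mul_trigamma (hb : ∀ k : ℕ, b ≠ -k) (hab : -1 < (b - a).re)
    (hba : b - a ≠ 0) :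
    HasSum (fun k : ℕ => pochRatio a (b + 1) k * trigamma (1 + k))
      (b / (b - a) * ((Real.pi : ℂ) ^ 2 / 6 - dilogMean a b)) := by
  have hb0 := ne_zero_of_ne_neg_natCast hb
  have hone := ne_neg_natCast_of_re_pos (z := 1) one_pos
  have hsum : Summable fun k : ℕ => pochRatio a (b + 1) k * trigamma (1 + k) := by
    refine summable_of_isBigO_rpow (isBigO_rpow_mul_rpow (isBigO_pochRatio a (b + 1))
      (isBigO_trigamma_add_natCast 1)) ?_
    simp only [Complex.sub_re, Complex.add_re, Complex.one_re] at hab ⊢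
    linarith
  have hlim : Tendsto (fun k : ℕ => pochRatio a b k * trigamma (1 + k)) atTop (𝓝 0) := by
    refine tendsto_zero_of_isBigO_rpow (isBigO_rpow_mul_rpow (isBigO_pochRatio a b)
      (isBigO_trigamma_add_natCast 1)) ?_
    rw [Complex.sub_re] at hab ⊢
    linarith
  have hparts (k : ℕ) : (b - a) / b * (pochRatio a (b + 1) k * trigamma (1 + k))
      + pochRatio a b (k + 1) * (((k : ℂ) + 1) ^ 2)⁻¹
      = pochRatio a b k * trigamma (1 + k)
        - pochRatio a b (k + 1) * trigamma (1 + (k + 1 : ℕ)) := by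
    rw [← mul_assoc, ← pochRatio_sub_succ a hb, Nat.cast_succ, ← add_assoc,
      trigamma_add_one (ne_neg_natCast_add hone k), add_comm (1 : ℂ)]
    ring
  have h := (hsum.hasSum.mul_left ((b - a) / b)).add (hasSum_dilogMean hab)
  simp_rw [hparts] at h
  have heq := h.unique (hasSum_sub_succ h.summable hlim)
  rw [pochRatio_zero, Nat.cast_zero, add_zero, trigamma_one, one_mul] at heq
  convert hsum.hasSum using 1
  rw [← heq]
  field_simp
  ring

theorem hasSum_pochRatio_mul_digamma_sq (hb : ∀ k : ℕ, b ≠ -k) (h : 0 < (b - a).re) :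
    HasSum (fun k : ℕ => pochRatio a (b + 1) k * Complex.digamma (1 + k) ^ 2)
      (b / (b - a) * ((Complex.digamma b - Complex.digamma (b - a) + Complex.digamma 1) ^ 2
        + trigamma (b - a) - trigamma b + dilogMean a b)) := by
  have hba := ne_zero_of_ne_neg_natCast (ne_neg_natCast_of_re_pos h)
  have hdiff := (hasSum_pochRatio_mul_digamma_sq_add_trigamma hb h).sub
    (hasSum_pochRatio_mul_trigamma hb (by linarith) hba)
  simpa only [← mul_sub, trigamma_one, add_sub_assoc, sub_sub_cancel, sub_self, add_zero]
    using hdiff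

end DilogMean

/-- The difference between the two sides of the identity
`∑ₖ ((u)ₖ + (v)ₖ) / ((u + v)ₖ k²) = π² / 6 + ψ'(u + v) - (ψ(u) - ψ(u + v)) (ψ(v) - ψ(u + v))`, the
mean of Euler's reflection formula `Li₂(x) + Li₂(1 - x) = π² / 6 - log x log (1 - x)` for a beta
variable `x` with parameters `u` and `v`. -/
noncomputable def reflectionDefect (u v : ℂ) : ℂ :=
  dilogMean u (u + v) + dilogMean v (u + v) - ((Real.pi : ℂ) ^ 2 / 6 + trigamma (u + v)
    - (Complex.digamma (u + v) - Complex.digamma u)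
      * (Complex.digamma (u + v) - Complex.digamma v))

section Reflection

variable {u v : ℂ}

lemma reflectionDefect_comm (u v : ℂ) : reflectionDefect u v = reflectionDefect v u := by
  rw [reflectionDefect, reflectionDefect, add_comm v u]
  ring

lemma reflectionDefect_add_one_left (hu : ∀ k : ℕ, u ≠ -k) (hv : ∀ k : ℕ, v ≠ -k)
    (huv : ∀ k : ℕ, u + v ≠ -k) (hu1 : -1 < u.re) (hv1 : -1 < v.re) :
    reflectionDefect (u + 1) v = reflectionDefect u v := by
  have hu0 := ne_zero_of_ne_neg_natCast hu
  have hv0 := ne_zero_of_ne_neg_natCast hv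
  have huv0 := ne_zero_of_ne_neg_natCast huv
  have hsub_u : u + v + 1 - u = v + 1 := by ring
  have hsub_v : u + v + 1 - v = u + 1 := by ring
  have hfirst := dilogMean_add_one_add_one hu0 huv (by simpa using hv1)
  have hsecond := dilogMean_add_one_right (a := v) huv (by simpa using hu1)
  rw [reflectionDefect, reflectionDefect, add_right_comm u 1 v, hfirst, hsecond, hsub_u, hsub_v,
    trigamma_add_one huv, Complex.digamma_apply_add_one u hu, Complex.digamma_apply_add_one v hv,
    Complex.digamma_apply_add_one _ huv]
  field_simp
  ring

lemma reflectionDefect_add_natCast_left (hu : ∀ k : ℕ, u ≠ -k) (hv : ∀ k : ℕ, v ≠ -k)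
    (huv : ∀ k : ℕ, u + v ≠ -k) (hu1 : -1 < u.re) (hv1 : -1 < v.re) (n : ℕ) :
    reflectionDefect (u + n) v = reflectionDefect u v := by
  induction n with
  | zero => simp
  | succ n ih =>
    have huvn : ∀ k : ℕ, u + n + v ≠ -k := by
      rw [add_right_comm]
      exact ne_neg_natCast_add huv n
    have hun : -1 < (u + n).re := by
      rw [Complex.add_re, Complex.natCast_re]
      linarith [n.cast_nonneg (α := ℝ)]
    rw [Nat.cast_succ, ← add_assoc,
      reflectionDefect_add_one_left (ne_neg_natCast_add hu n) hv huvn hun hv1, ih]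

lemma tendsto_pochRatio_add_natCast (a b : ℂ) (k : ℕ) :
    Tendsto (fun n : ℕ => pochRatio (a + n) (b + n) k) atTop (𝓝 1) := by
  induction k with
  | zero => simp
  | succ k ih =>
    have hq : Tendsto (fun n : ℕ => (a + n + k) / (b + n + k)) atTop (𝓝 1) := by
      simpa [add_right_comm] using
        tendsto_add_mul_div_add_mul_atTop_nhds (a + k) (b + k) 1 one_ne_zero
    simpa only [pochRatio_succ, mul_one] using ih.mul hq

lemma eventually_norm_add_natCast_le (u : ℂ) (hv : 0 < v.re) :
    ∀ᶠ n : ℕ in atTop, ‖u + n‖ ≤ ‖u + v + n‖ := by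
  have hlim : Tendsto (fun n : ℕ => v.re * (u.re + n)) atTop atTop :=
    (tendsto_atTop_add_const_left _ _ tendsto_natCast_atTop_atTop).const_mul_atTop hv
  filter_upwards [hlim.eventually_ge_atTop |v.im * u.im|] with n hn
  rw [← sq_le_sq₀ (norm_nonneg _) (norm_nonneg _), Complex.sq_norm, Complex.sq_norm,
    Complex.normSq_apply, Complex.normSq_apply]
  simp only [Complex.add_re, Complex.add_im, Complex.natCast_re, Complex.natCast_im]
  nlinarith [sq_nonneg v.re, sq_nonneg v.im, neg_abs_le (v.im * u.im)]

lemma eventually_norm_pochRatio_add_natCast_le_one (u : ℂ) (hv : 0 < v.re) :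
    ∀ᶠ n : ℕ in atTop, ∀ k, ‖pochRatio (u + n) (u + v + n) k‖ ≤ 1 := by
  filter_upwards [eventually_forall_ge_atTop.2 (eventually_norm_add_natCast_le u hv)] with n hn k
  induction k with
  | zero => simp
  | succ k ih =>
    rw [pochRatio_succ, norm_mul, norm_div]
    refine mul_le_one₀ ih (by positivity) (div_le_one_of_le₀ ?_ (norm_nonneg _))
    simpa only [Nat.cast_add, add_assoc] using hn (n + k) (n.le_add_right k)

lemma tendsto_dilogMean_add_natCast (u : ℂ) (hv : 0 < v.re) :
    Tendsto (fun n : ℕ => dilogMean (u + n) (u + v + n)) atTop (𝓝 ((Real.pi : ℂ) ^ 2 / 6)) := by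
  rw [← hasSum_inv_add_one_sq.tsum_eq]
  refine tendsto_tsum_of_dominated_convergence hasSum_inv_add_one_sq.summable.norm (fun k => ?_) ?_
  · simpa only [one_mul] using (tendsto_pochRatio_add_natCast u (u + v) (k + 1)).mul_const _
  · filter_upwards [eventually_norm_pochRatio_add_natCast_le_one u hv] with n hn k
    rw [norm_mul]
    exact mul_le_of_le_one_left (norm_nonneg _) (hn _)

lemma tendsto_reflectionDefect_add_natCast (huv : ∀ k : ℕ, u + v ≠ -k) (hv : 0 < v.re) :
    Tendsto (fun n : ℕ => reflectionDefect (u + n) v) atTop (𝓝 0) := by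
  have hsecond : Tendsto (fun n : ℕ => dilogMean v (u + v + n)) atTop (𝓝 0) :=
    tendsto_zero_of_isBigO_rpow
      (isBigO_tsum_pochRatio_add_natCast v (u + v) isBigO_inv_natCast_add_one_sq) (by norm_num)
  have htrigamma : Tendsto (fun n : ℕ => trigamma (u + v + n)) atTop (𝓝 0) :=
    tendsto_zero_of_isBigO_rpow (isBigO_trigamma_add_natCast (u + v)) (by norm_num)
  have hdigamma : Tendsto (fun n : ℕ => (Complex.digamma (u + v + n) - Complex.digamma (u + n))
      * (Complex.digamma (u + v + n) - Complex.digamma v)) atTop (𝓝 0) := by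
    have hleft := isBigO_digamma_add_natCast_sub huv v
    have hright := isLittleO_digamma_add_natCast_sub_const huv (Complex.digamma v)
    rw [add_sub_cancel_right] at hleft
    refine (isLittleO_one_iff ℝ).1 ((hleft.mul_isLittleO hright).trans_isBigO ?_)
    refine IsBigO.of_bound 1 (Eventually.of_forall fun n => ?_)
    rw [Real.rpow_neg_one, norm_one, one_mul, Real.norm_of_nonneg (by positivity)]
    exact inv_mul_le_one
  have h := ((tendsto_dilogMean_add_natCast u hv).add hsecond).sub
    ((htrigamma.const_add ((Real.pi : ℂ) ^ 2 / 6)).sub hdigamma)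
  simp only [add_zero, sub_zero, sub_self] at h
  simpa only [reflectionDefect, add_right_comm u _ v] using h

theorem reflectionDefect_eq_zero (hu : ∀ k : ℕ, u ≠ -k) (hv : ∀ k : ℕ, v ≠ -k)
    (huv : ∀ k : ℕ, u + v ≠ -k) (hu1 : -1 < u.re) (hv1 : -1 < v.re) :
    reflectionDefect u v = 0 := by
  have huv1 : ∀ k : ℕ, v + 1 + u ≠ -k := by
    rw [add_right_comm, add_comm v]
    exact ne_neg_natCast_add_one huv
  have hv0 : 0 < (v + 1).re := by
    rw [Complex.add_re, Complex.one_re]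
    linarith
  rw [reflectionDefect_comm, ← reflectionDefect_add_one_left hv hu (by rwa [add_comm]) hv1 hu1,
    reflectionDefect_comm]
  rw [add_comm] at huv1
  refine tendsto_nhds_unique (tendsto_const_nhds.congr fun n => ?_)
    (tendsto_reflectionDefect_add_natCast huv1 hv0)
  exact (reflectionDefect_add_natCast_left hu (ne_neg_natCast_add_one hv) huv1 hu1
    (by linarith) n).symm

end Reflection

lemma genHypTerm_eq_pochRatio_mul (a b : ℂ) (k : ℕ) :
    genHypTerm [1, 1, 1, a] [2, 2, b] 1 k = pochRatio a b k * (((k : ℂ) + 1) ^ 2)⁻¹ := by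
  have hfac : (k.factorial : ℂ) ≠ 0 := by exact_mod_cast k.factorial_ne_zero
  rw [← inv_pow, ← pochRatio_one_two]
  simp only [genHypTerm, List.map_cons, List.map_nil, List.prod_cons, List.prod_nil, one_pow,
    pochRatio, ascPochhammer_eval_one]
  field_simp

lemma summable_genHypTerm {a b : ℂ} (hab : -1 < (b - a).re) :
    Summable (genHypTerm [1, 1, 1, a] [2, 2, b] 1) := by
  simp_rw [funext (genHypTerm_eq_pochRatio_mul a b)]
  refine summable_of_isBigO_rpow
    (isBigO_rpow_mul_rpow (isBigO_pochRatio a b) isBigO_inv_natCast_add_one_sq) ?_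
  rw [Complex.sub_re] at hab ⊢
  linarith

lemma dilogMean_eq_genHyp (a b : ℂ) :
    dilogMean a b = a / b * genHyp [1, 1, 1, a + 1] [2, 2, b + 1] 1 := by
  rw [dilogMean, genHyp, ← tsum_mul_left]
  refine tsum_congr fun k => ?_
  rw [genHypTerm_eq_pochRatio_mul, pochRatio_succ', mul_assoc]

lemma dilogMean_eq_sub_genHyp {c b : ℂ} (hc : ∀ k : ℕ, c ≠ -k) (hb : ∀ k : ℕ, b ≠ -k)
    (hbc : ∀ k : ℕ, b - c ≠ -k) (hc1 : -1 < c.re) (hbc1 : -1 < (b - c).re) :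
    dilogMean c b = (Real.pi : ℂ) ^ 2 / 6 + trigamma b
      - (Complex.digamma b - Complex.digamma c) * (Complex.digamma b - Complex.digamma (b - c))
      - (b - c) / b * genHyp [1, 1, 1, b - c + 1] [2, 2, b + 1] 1 := by
  have h := reflectionDefect_eq_zero hc hbc (by rwa [add_sub_cancel]) hc1 hbc1
  rw [reflectionDefect, add_sub_cancel, dilogMean_eq_genHyp (b - c)] at h
  linear_combination h

lemma hasSum_Gamma_mul_div_Gamma {c b s : ℂ} {f : ℕ → ℂ} (hc : ∀ k : ℕ, c ≠ -k)
    (hb : ∀ k : ℕ, b ≠ -k) (h : HasSum (fun l => pochRatio c b l * f l) s) :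
    HasSum (fun l : ℕ => Complex.Gamma (c + l) * f l / Complex.Gamma (b + l))
      (Complex.Gamma c / Complex.Gamma b * s) := by
  refine (h.mul_left _).congr_fun fun l => ?_
  rw [← mul_assoc, ← Gamma_add_natCast_div hc hb, div_mul_eq_mul_div]

theorem theorem4p11 (c m : ℂ) (hc : -1 < c.re) (hc0 : c ≠ 0)
    (hmc : 0 < (m - c).re) (hm0 : m ≠ 0) (hm1 : m ≠ 1) :
    Summable (genHypTerm [1, 1, 1, m - c] [2, 2, m] 1) ∧
    (1 < (m - c).re →
      HasSum
        (fun l : ℕ => Complex.Gamma (c + l) * Complex.digamma (1 + l) ^ 2 / Complex.Gamma (m + l))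
        (-(Complex.Gamma c / Complex.Gamma m) * genHyp [1, 1, 1, m - c] [2, 2, m] 1
          + Complex.Gamma c / (Complex.Gamma (m - 1) * (m - 1 - c)) *
            ((Real.pi : ℂ) ^ 2 / 6 + (Real.eulerMascheroniConstant : ℂ) ^ 2
              + Complex.digamma (m - 1 - c) *
                (2 * (Real.eulerMascheroniConstant : ℂ)
                  - Complex.digamma (m - 1) - Complex.digamma c)
              + trigamma (m - 1 - c)
              + Complex.digamma (m - 1 - c) ^ 2
              - Complex.digamma (m - 1) *
                (2 * (Real.eulerMascheroniConstant : ℂ) - Complex.digamma c)))) ∧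
    (m ≠ c + 1 →
      HasSum
        (fun l : ℕ => Complex.Gamma (c + l) * trigamma (1 + l) / Complex.Gamma (m + l))
        (Complex.Gamma c / Complex.Gamma m * genHyp [1, 1, 1, m - c] [2, 2, m] 1
          - Complex.Gamma c / (Complex.Gamma (m - 1) * (m - 1 - c)) *
            (trigamma (m - 1)
              - (Complex.digamma (m - 1) - Complex.digamma (m - 1 - c)) *
                (Complex.digamma (m - 1) - Complex.digamma c)))) := by
  obtain ⟨b, rfl⟩ : ∃ b, m = b + 1 := ⟨m - 1, (sub_add_cancel m 1).symm⟩
  have hbc : b + 1 - c = b - c + 1 := add_sub_right_comm b 1 c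
  rw [hbc, Complex.add_re, Complex.one_re] at hmc ⊢
  have hbc1 : -1 < (b - c).re := by linarith
  have hcN := ne_neg_natCast_of_neg_one_lt_re hc hc0
  have hm : -1 < (b + 1).re := by
    simp only [Complex.sub_re, Complex.add_re, Complex.one_re] at hmc ⊢
    linarith
  have hmN := ne_neg_natCast_of_neg_one_lt_re hm hm0
  have hb0 : b ≠ 0 := by simpa using hm1
  have hbN := ne_neg_natCast_of_add_one hmN hb0
  rw [add_sub_cancel_right]
  refine ⟨summable_genHypTerm (by simpa using hc), fun hre => ?_, fun hne => ?_⟩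
  · have hbc0 : 0 < (b - c).re := by linarith
    have hbcN := ne_neg_natCast_of_re_pos hbc0
    have hsub := ne_zero_of_ne_neg_natCast hbcN
    convert hasSum_Gamma_mul_div_Gamma hcN hmN (hasSum_pochRatio_mul_digamma_sq hbN hbc0) using 1
    rw [dilogMean_eq_sub_genHyp hcN hbN hbcN hc hbc1, Complex.digamma_one,
      Complex.Gamma_add_one b hb0]
    field_simp
    ring
  · have hsub : b - c ≠ 0 := fun h => hne (by rw [sub_eq_zero.1 h])
    have hbcN := ne_neg_natCast_of_neg_one_lt_re hbc1 hsub
    convert hasSum_Gamma_mul_div_Gamma hcN hmN (hasSum_pochRatio_mul_trigamma hbN hbc1 hsub)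
      using 1
    rw [dilogMean_eq_sub_genHyp hcN hbN hbcN hc hbc1, Complex.Gamma_add_one b hb0]
    field_simp
    ring
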